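/- Let $V$ be a closed isometric operator in a complex Hilbert space $H$ (defined on a subspace $D(V)\subseteq H$), and let $U\supseteq V$ be a unitary operator in a Hilbert space $\widetilde H\supseteq H$, with orthogonal spectral measure $E(\delta)$, $\delta\in\mathfrak B(\mathbb T)$, so that $U=\int_{\mathbb T}\zeta\,dE(\zeta)$, where $\mathbb T=\{z\in\mathbb C:|z|=1\}$. Let $P$ be the orthogonal projection of $\widetilde H$ onto $H$, let $$\mathbf F(\delta)=P\,E(\delta)|_H,\qquad \delta\in\mathfrak B(\mathbb T),$$ be the spectral measure of $V$ corresponding to $U$, and let $$\mathbf R_z(V)=P\,(I_{\widetilde H}-zU)^{-1}|_H,\qquad z\in\mathbb D\cup\mathbb D_e,$$ be the corresponding generalized resolvent, where $\mathbb D=\{|z|<1\}$ and $\mathbb D_e=\{|z|>1\}$. Then for every nonempty open arc $\Delta=\{e^{it}:a<t<b\}$ of $\mathbb T$ (where $a<b\le a+2\pi$) the following two conditions are equivalent: (i) $\mathbf F(\Delta)=0$; (ii) $\mathbf R_z(V)$ has an analytic continuation, as a function with values in the bounded operators on $H$ with the operator norm, to the set $\mathbb D\cup\mathbb D_e\cup\overline\Delta$,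 where $\overline\Delta=\{z\in\mathbb C:\overline z\in\Delta\}$. -/

import Mathlib

noncomputable section

open MeasureTheory

/-- The unit circle `𝕋 = {z ∈ ℂ : |z| = 1}` as a topological and (Borel) measurable space. -/
abbrev UnitCircle : Type := Metric.sphere (0 : ℂ) 1

/-- A (nonempty) open arc `{e^{it} : a < t < b}` of the unit circle, `a < b ≤ a + 2π`. -/
def IsOpenArc (Δ : Set UnitCircle) : Prop :=
  ∃ a b : ℝ, a < b ∧ b ≤ a + 2 * Real.pi ∧
    Δ = {ζ : UnitCircle | ∃ t ∈ Set.Ioo a b, (ζ : ℂ) = Complex.exp (t * Complex.I)}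

/-- The conjugate set `{z ∈ ℂ : conj z ∈ Δ}` of a subset `Δ` of the unit circle. -/
def conjArc (Δ : Set UnitCircle) : Set ℂ :=
  {z : ℂ | ∃ ζ ∈ Δ, (starRingEnd ℂ) z = (ζ : ℂ)}

/-- The set `{|z| ≠ 1}`, i.e. the union of the open unit disc and of the exterior `{|z| > 1}`
of the closed unit disc. -/
def offCircle : Set ℂ := {z : ℂ | ‖z‖ < 1} ∪ {z : ℂ | 1 < ‖z‖}

/-- The function `R`, considered on `S₀` only, has an analytic continuation to `S`. -/
def HasAnalyticContinuation {A : Type*} [NormedAddCommGroup A] [NormedSpace ℂ A]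
    (R : ℂ → A) (S₀ S : Set ℂ) : Prop :=
  ∃ G : ℂ → A, AnalyticOnNhd ℂ G S ∧ Set.EqOn G R S₀

/-- A closed isometric operator in `H`, defined on a linear subspace `V.domain` of `H`. -/
structure IsClosedIsometric {H : Type*} [NormedAddCommGroup H] [InnerProductSpace ℂ H]
    (V : H →ₗ.[ℂ] H) : Prop where
  closed : V.IsClosed
  isometric : ∀ x : V.domain, ‖V x‖ = ‖(x : H)‖

/-- A unitary extension `U ⊇ V` in a Hilbert space `K ⊇ H`; the inclusion of `H` in `K` is a linear
isometry `incl`. -/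
structure UnitaryExtension {H : Type*} [NormedAddCommGroup H] [InnerProductSpace ℂ H]
    (V : H →ₗ.[ℂ] H) (K : Type*) [NormedAddCommGroup K] [InnerProductSpace ℂ K]
    [CompleteSpace K] where
  /-- the inclusion `H ⊆ K` -/
  incl : H →ₗᵢ[ℂ] K
  /-- the unitary operator `U` -/
  op : K →L[ℂ] K
  op_unitary : op ∈ unitary (K →L[ℂ] K)
  extends_op : ∀ x : V.domain, op (incl (x : H)) = incl (V x)

/-- An orthogonal spectral measure (projection-valued measure) on the Borel sets of the unit circle:
its values are orthogonal projections in `K`, the value at the whole circle is the identity, and it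
is countably additive in the strong operator topology. Values at non-Borel sets are irrelevant. -/
structure OrthogonalSpectralMeasure (K : Type*) [NormedAddCommGroup K] [InnerProductSpace ℂ K]
    [CompleteSpace K] where
  /-- the operator `E(δ)` -/
  toFun : Set UnitCircle → K →L[ℂ] K
  isStarProjection : ∀ δ : Set UnitCircle, MeasurableSet δ → IsStarProjection (toFun δ)
  univ : toFun Set.univ = 1
  iUnion : ∀ δ : ℕ → Set UnitCircle, (∀ n, MeasurableSet (δ n)) →
    (∀ m n, m ≠ n → Disjoint (δ m) (δ n)) →
    ∀ x : K, HasSum (fun n => toFun (δ n) x) (toFun (⋃ n, δ n) x)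

namespace OrthogonalSpectralMeasure

variable {K : Type*} [NormedAddCommGroup K] [InnerProductSpace ℂ K] [CompleteSpace K]

theorem toFun_empty (E : OrthogonalSpectralMeasure K) (x : K) : E.toFun ∅ x = 0 := by
  have h := E.iUnion (fun _ => ∅) (fun _ => MeasurableSet.empty) (fun _ _ _ => disjoint_bot_left) x
  simpa using (tendsto_nhds_unique h.summable.tendsto_atTop_zero tendsto_const_nhds).symm

theorem re_inner_nonneg (E : OrthogonalSpectralMeasure K) {δ : Set UnitCircle}
    (hδ : MeasurableSet δ) (x : K) : 0 ≤ (inner ℂ x (E.toFun δ x)).re := by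
  have hp := E.isStarProjection δ hδ
  have h1 : E.toFun δ (E.toFun δ x) = E.toFun δ x :=
    congrArg (fun T : K →L[ℂ] K => T x) hp.isIdempotentElem.eq
  have h2 : inner ℂ x (E.toFun δ x) = inner ℂ (E.toFun δ x) (E.toFun δ x) := by
    have h3 := hp.isSelfAdjoint.isSymmetric x (E.toFun δ x)
    simp only [ContinuousLinearMap.coe_coe, h1] at h3
    exact h3.symm
  rw [h2]
  exact inner_self_nonneg (𝕜 := ℂ)

/-- The scalar measure `δ ↦ (E(δ) x, x)` on the unit circle. -/
def scalarMeasure (E : OrthogonalSpectralMeasure K) (x : K) : Measure UnitCircle :=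
  Measure.ofMeasurable (fun δ _ => ENNReal.ofReal (inner ℂ x (E.toFun δ x)).re)
    (by simp [E.toFun_empty])
    (by
      intro f hf hd
      have h := E.iUnion f hf (fun m n hmn => hd hmn) x
      have h' : HasSum (fun n => (inner ℂ x (E.toFun (f n) x)).re)
          (inner ℂ x (E.toFun (⋃ n, f n) x)).re :=
        (h.mapL (innerSL ℂ x)).mapL Complex.reCLM
      rw [← h'.tsum_eq]
      exact ENNReal.ofReal_tsum_of_nonneg (fun n => E.re_inner_nonneg (hf n) x) h'.summable)

theorem scalarMeasure_apply (E : OrthogonalSpectralMeasure K) (x : K) {δ : Set UnitCircle}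
    (hδ : MeasurableSet δ) :
    E.scalarMeasure x δ = ENNReal.ofReal (inner ℂ x (E.toFun δ x)).re :=
  Measure.ofMeasurable_apply δ hδ

/-- `E` is the orthogonal spectral measure of the operator `U`: `U = ∫ ζ dE(ζ)` in the weak sense,
`(U x, x) = ∫ ζ d(E(ζ) x, x)` for all `x` (the inner product of Mathlib is linear in its second
argument; by polarization the same identity holds for the sesquilinear forms). -/
def IsSpectralMeasureOf (E : OrthogonalSpectralMeasure K) (U : K →L[ℂ] K) : Prop :=
  ∀ x : K, inner ℂ x (U x) = ∫ ζ : UnitCircle, (ζ : ℂ) ∂(E.scalarMeasure x)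

end OrthogonalSpectralMeasure

namespace UnitaryExtension

variable {H : Type*} [NormedAddCommGroup H] [InnerProductSpace ℂ H] [CompleteSpace H]
  {V : H →ₗ.[ℂ] H}
  {K : Type*} [NormedAddCommGroup K] [InnerProductSpace ℂ K] [CompleteSpace K]

/-- The compression `P T|_H` to `H` of an operator `T` in `K ⊇ H`, where `P` is the orthogonal
projection of `K` onto `H` (as a map to `H`, it is the adjoint of the inclusion). -/
def compression (W : UnitaryExtension V K) (T : K →L[ℂ] K) : H →L[ℂ] H :=
  (ContinuousLinearMap.adjoint W.incl.toContinuousLinearMap) ∘L T ∘L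
    W.incl.toContinuousLinearMap

/-- The generalized resolvent `R_z = P (1 - z U)⁻¹|_H` of `V` corresponding to the extension `U`.
It is meaningful for `|z| ≠ 1`, where `1 - z U` is invertible. -/
def generalizedResolvent (W : UnitaryExtension V K) (z : ℂ) : H →L[ℂ] H :=
  W.compression (Ring.inverse (1 - z • W.op))

/-- The spectral measure `F(δ) = P E(δ)|_H` of `V` corresponding to the extension `U`, where `E` is
the orthogonal spectral measure of `U`. -/
def spectralMeasure (W : UnitaryExtension V K) (E : OrthogonalSpectralMeasure K)
    (δ : Set UnitCircle) : H →L[ℂ] H :=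
  W.compression (E.toFun δ)

end UnitaryExtension

end

/-!
Let `μ_x = (E(·) x, x)`. On the range of `E(A)` the operator `1 - z U` acts like multiplication by
`1 - z ζ` on `A`, since `‖(1 - z U) E(A) x‖² = ∫_A |1 - z ζ|² dμ_x`.

If `F(Δ) = 0`, then `H` lies in the range of `E(Δᶜ)`, so `U` may be replaced by `U E(Δᶜ)` in the
generalized resolvent; as `Δᶜ` is compact, `1 - z U E(Δᶜ)` is invertible whenever `z⁻¹ ∉ Δᶜ`, which
gives the analytic continuation.

Conversely, `2 Re (R_z x, x) - ‖x‖² = (1 - |z|²) ‖(1 - z U)⁻¹ x‖²` is nonnegative inside the disc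
and nonpositive outside, so a continuous extension of it vanishes on `conj Δ`. A differentiable one
is therefore `O(ε)` at `(1 - ε) conj ζ`, `ζ ∈ Δ`, and it bounds `μ_x` of the `ε`-ball around `ζ` by
`O(ε²)`. That is comparable to the area of a planar disc of radius `ε`, and the circle has area
zero; a covering argument then gives `μ_x(Δ) = 0`.
-/

section

open MeasureTheory Filter Topology Metric Asymptotics

theorem measure_eq_zero_of_isBigO_closedBall {α : Type*} [MetricSpace α]
    [SecondCountableTopology α] [HasBesicovitchCovering α] [MeasurableSpace α] [BorelSpace α]
    {ρ ν : Measure α} [IsFiniteMeasure ρ] [IsLocallyFiniteMeasure ν] {s : Set α} (hs : ν s = 0)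
    (h : ∀ x ∈ s, (fun ε => ρ.real (closedBall x ε)) =O[𝓝[>] 0] fun ε => ν.real (closedBall x ε)) :
    ρ s = 0 := by
  let t (n : ℕ) : Set α := {x ∈ s | ∀ᶠ ε in 𝓝[>] 0, ρ (closedBall x ε) ≤ n * ν (closedBall x ε)}
  have hst : s ⊆ ⋃ n, t n := fun x hx => by
    obtain ⟨C, hC⟩ := (h x hx).bound
    obtain ⟨n, hn⟩ := exists_nat_ge C
    refine Set.mem_iUnion.mpr ⟨n, hx, hC.mono fun ε hε => ?_⟩
    rw [Real.norm_of_nonneg measureReal_nonneg, Real.norm_of_nonneg measureReal_nonneg] at hε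
    calc ρ (closedBall x ε) = ENNReal.ofReal (ρ.real (closedBall x ε)) := (ofReal_measureReal).symm
      _ ≤ ENNReal.ofReal (n * ν.real (closedBall x ε)) := by
        gcongr
        exact hε.trans (by gcongr)
      _ ≤ n * ν (closedBall x ε) := by
        rw [ENNReal.ofReal_mul n.cast_nonneg, ENNReal.ofReal_natCast]
        gcongr
        exact ENNReal.ofReal_toReal_le
  refine measure_mono_null hst (measure_iUnion_null fun n => le_antisymm ?_ zero_le)
  have hle : ρ (t n) ≤ ((n : NNReal) • ν) (t n) :=
    (Besicovitch.vitaliFamily ρ).measure_le_of_frequently_le _ .rfl _ fun x hx =>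
      (Besicovitch.tendsto_filterAt ρ x).frequently (hx.2.mono fun ε hε => hε).frequently
  rwa [Measure.smul_apply, measure_mono_null (Set.sep_subset s _) hs, smul_zero] at hle

theorem measure_eq_zero_of_isBigO_closedBall_sq (μ : Measure UnitCircle) [IsFiniteMeasure μ]
    {A : Set UnitCircle}
    (h : ∀ ζ ∈ A, (fun ε => μ.real (closedBall ζ ε)) =O[𝓝[>] 0] fun ε => ε ^ 2) : μ A = 0 := by
  have hcoe : MeasurableEmbedding ((↑) : UnitCircle → ℂ) :=
    .subtype_coe isClosed_sphere.measurableSet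
  have hnull : volume (((↑) : UnitCircle → ℂ) '' A) = 0 :=
    measure_mono_null (t := sphere (0 : ℂ) 1) (Set.image_subset_iff.mpr fun ζ _ => ζ.2)
      (Measure.addHaar_sphere volume 0 1)
  suffices (μ.map (↑)) (((↑) : UnitCircle → ℂ) '' A) = 0 by
    rwa [hcoe.map_apply, Set.preimage_image_eq _ Subtype.val_injective] at this
  refine measure_eq_zero_of_isBigO_closedBall hnull (Set.forall_mem_image.mpr fun ζ hζ => ?_)
  have hball (ε : ℝ) : (μ.map (↑)).real (closedBall (ζ : ℂ) ε) = μ.real (closedBall ζ ε) := by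
    rw [measureReal_def, hcoe.map_apply]
    rfl
  have harea (ε : ℝ) (hε : 0 < ε) : volume.real (closedBall (ζ : ℂ) ε) = Real.pi * ε ^ 2 := by
    simp [measureReal_def, hε.le, mul_comm]
  simp only [hball]
  exact (h ζ hζ).trans <| (isBigO_self_const_mul Real.pi_ne_zero _ _).congr' .rfl <|
    eventually_nhdsWithin_of_forall fun ε hε => (harea ε hε).symm

theorem integrable_of_continuous (μ : Measure UnitCircle) [IsFiniteMeasure μ] {F : Type*}
    [NormedAddCommGroup F] {f : UnitCircle → F} (hf : Continuous f) : Integrable f μ :=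
  hf.integrable_of_hasCompactSupport (.of_compactSpace f)

theorem IsOpenArc.isOpen {Δ : Set UnitCircle} (hΔ : IsOpenArc Δ) : IsOpen Δ := by
  obtain ⟨a, b, -, -, rfl⟩ := hΔ
  have himage : IsOpen (Complex.exp '' {w : ℂ | w.im ∈ Set.Ioo a b}) :=
    Complex.isOpenMap_exp _ (isOpen_Ioo.preimage Complex.continuous_im)
  convert! himage.preimage (continuous_subtype_val (p := (· ∈ sphere (0 : ℂ) 1))) using 1
  ext ζ
  refine ⟨fun ⟨t, ht, h⟩ => ⟨t * Complex.I, by simpa using ht, h.symm⟩, fun ⟨w, hw, h⟩ => ?_⟩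
  have hre : w.re = 0 := by
    rw [← Real.exp_eq_one_iff, ← Complex.norm_exp, h, norm_eq_of_mem_sphere]
  refine ⟨w.im, hw, ?_⟩
  rw [← h]
  congr 1
  exact Complex.ext (by simpa using hre) (by simp)

theorem mul_ne_one_of_notMem {Δ : Set UnitCircle} {z : ℂ} {ξ : UnitCircle}
    (hz : z ∈ offCircle ∪ conjArc Δ) (hξ : ξ ∉ Δ) : z * ξ ≠ 1 := by
  intro h
  have hzξ : z = starRingEnd ℂ ξ :=
    (eq_inv_of_mul_eq_one_left h).trans (Complex.inv_eq_conj (norm_eq_of_mem_sphere ξ))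
  have hnorm : ‖z‖ = 1 := by simp [hzξ]
  rcases hz with (hlt | hgt) | ⟨ζ, hζ, hconj⟩
  · exact hlt.ne hnorm
  · exact hgt.ne' hnorm
  · rw [hzξ, Complex.conj_conj] at hconj
    exact hξ (Subtype.ext hconj ▸ hζ)

theorem norm_ofReal_mul_conj (ζ : UnitCircle) {r : ℝ} (hr : 0 ≤ r) :
    ‖r * starRingEnd ℂ (ζ : ℂ)‖ = r := by
  simp [hr]

theorem ofReal_mul_conj_mem_offCircle (ζ : UnitCircle) {ε : ℝ} (hε : ε ∈ Set.Ioo (0 : ℝ) 1) :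
    (1 - ε : ℝ) * starRingEnd ℂ (ζ : ℂ) ∈ offCircle := by
  left
  rw [Set.mem_ofPred_eq, norm_ofReal_mul_conj ζ (by linarith [hε.2])]
  linarith [hε.1]

theorem norm_one_sub_mul_le_of_mem_closedBall {ζ ξ : UnitCircle} {ε : ℝ} (hε0 : 0 ≤ ε)
    (hξ : ξ ∈ closedBall ζ ε) : ‖1 - (1 - ε : ℝ) * starRingEnd ℂ ζ * ξ‖ ≤ 2 * ε := by
  have hconj : (ζ : ℂ) * starRingEnd ℂ ζ = 1 := by simp [Complex.mul_conj']
  calc ‖1 - (1 - ε : ℝ) * starRingEnd ℂ ζ * ξ‖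
      = ‖(ζ : ℂ) * (1 - (1 - ε : ℝ) * starRingEnd ℂ ζ * ξ)‖ := by
        rw [norm_mul, norm_eq_of_mem_sphere, one_mul]
    _ = ‖((ζ : ℂ) - ξ) + ε * ξ‖ := by
        congr 1
        push_cast
        linear_combination (-(1 - (ε : ℂ)) * ξ) * hconj
    _ ≤ ε + ε := norm_add_le_of_le ?_ ?_
    _ = 2 * ε := (two_mul ε).symm
  · rwa [mem_closedBall', Subtype.dist_eq, dist_eq_norm] at hξ
  · simp [abs_of_nonneg hε0]

section Operators

theorem isStarNormal_mul_of_commute_star {R : Type*} [Semigroup R] [StarMul R] {a b : R}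
    (ha : IsStarNormal a) (hb : IsStarNormal b) (hab : Commute a (star b)) :
    IsStarNormal (a * b) := by
  refine ⟨?_⟩
  rw [star_mul]
  have hba : Commute (star a) b := by simpa using hab.star_star
  exact (hab.symm.mul_right hb.star_comm_self).mul_left (ha.star_comm_self.mul_right hba)

theorem inverse_one_sub_mul_mul {R : Type*} [Ring R] {a p : R} (hp : IsIdempotentElem p)
    (hap : Commute a p) (ha : IsUnit (1 - a)) (hap' : IsUnit (1 - a * p)) :
    Ring.inverse (1 - a * p) * p = Ring.inverse (1 - a) * p := by
  have hcomm : Commute (1 - a) p := (Commute.one_left p).sub_left hap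
  have hinv : Commute (Ring.inverse (1 - a)) p := by
    obtain ⟨u, hu⟩ := ha
    rw [← hu, Ring.inverse_unit]
    exact Commute.units_inv_left (hu ▸ hcomm)
  have hmul : (1 - a) * p = (1 - a * p) * p := by rw [sub_mul, sub_mul, mul_assoc, hp.eq]
  rw [Ring.inverse_mul_eq_iff_eq_mul _ _ _ hap']
  calc p = p * ((1 - a) * Ring.inverse (1 - a)) := by rw [Ring.mul_inverse_cancel _ ha, mul_one]
    _ = (1 - a * p) * p * Ring.inverse (1 - a) := by rw [← mul_assoc, ← hcomm.eq, hmul]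
    _ = (1 - a * p) * (Ring.inverse (1 - a) * p) := by rw [mul_assoc, hinv.eq]

variable {K : Type*} [NormedAddCommGroup K] [InnerProductSpace ℂ K]

theorem eq_of_inner_apply_self {S T : K →L[ℂ] K}
    (h : ∀ x, inner ℂ x (S x) = inner ℂ x (T x)) : S = T :=
  ContinuousLinearMap.coe_injective <| (ext_inner_map _ _).mp fun x => by
    change inner ℂ (S x) x = inner ℂ (T x) x
    rw [← inner_conj_symm, h x, inner_conj_symm]

variable [CompleteSpace K]

theorem isUnit_of_isStarNormal_of_antilipschitzWith {T : K →L[ℂ] K} (hT : IsStarNormal T)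
    {c : NNReal} (h : AntilipschitzWith c T) : IsUnit T := by
  rw [ContinuousLinearMap.isUnit_iff_bijective,
    ContinuousLinearMap.bijective_iff_dense_range_and_antilipschitz]
  refine ⟨?_, c, h⟩
  rw [Submodule.topologicalClosure_eq_top_iff,
    ContinuousLinearMap.IsStarNormal.orthogonal_range hT]
  exact LinearMap.ker_eq_bot.mpr h.injective

theorem isUnit_one_sub_smul_mul_of_bounded_below {U Q : K →L[ℂ] K} (hU : IsStarNormal U)
    (hQ : IsStarProjection Q) (hUQ : Commute U Q) {z : ℂ} {c : ℝ} (hc : 0 < c)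
    (h : ∀ x, c * ‖Q x‖ ≤ ‖Q x - z • U (Q x)‖) : IsUnit (1 - z • (U * Q)) := by
  have hUQn : IsStarNormal (U * Q) :=
    isStarNormal_mul_of_commute_star hU hQ.isSelfAdjoint.isStarNormal
      (by rwa [hQ.isSelfAdjoint.star_eq])
  have hsub : IsStarNormal (1 - z • (U * Q)) := inferInstance
  refine isUnit_of_isStarNormal_of_antilipschitzWith (c := ⟨c⁻¹ + 1, by positivity⟩) hsub
    (ContinuousLinearMap.antilipschitz_of_bound _ fun x => ?_)
  set T := 1 - z • (U * Q) with hT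
  have hQUQ : Q * (U * Q) = U * Q := by
    rw [← mul_assoc, ← hUQ.eq, mul_assoc, hQ.isIdempotentElem.eq]
  have hQT : Q * T = Q - z • (U * Q) := by rw [hT, mul_sub, mul_one, mul_smul_comm, hQUQ]
  have hQT' : (1 - Q) * T = 1 - Q := by
    rw [sub_mul, one_mul, hQT, hT]
    abel
  have hrange : ‖Q x‖ ≤ c⁻¹ * ‖T x‖ := by
    rw [le_inv_mul_iff₀ hc]
    calc c * ‖Q x‖ ≤ ‖(Q * T) x‖ := by rw [hQT]; exact h x
      _ ≤ ‖T x‖ := (Q.le_of_opNorm_le hQ.norm_le (T x)).trans_eq (one_mul _)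
  have hker : ‖x - Q x‖ ≤ ‖T x‖ :=
    calc ‖x - Q x‖ = ‖((1 - Q) * T) x‖ := by rw [hQT']; rfl
      _ ≤ ‖T x‖ := ((1 - Q).le_of_opNorm_le hQ.one_sub.norm_le (T x)).trans_eq (one_mul _)
  calc ‖x‖ ≤ ‖Q x‖ + ‖x - Q x‖ := norm_le_norm_add_norm_sub' x (Q x)
    _ ≤ c⁻¹ * ‖T x‖ + ‖T x‖ := add_le_add hrange hker
    _ = (c⁻¹ + 1) * ‖T x‖ := by ring

end Operators

namespace OrthogonalSpectralMeasure

variable {K : Type*} [NormedAddCommGroup K] [InnerProductSpace ℂ K] [CompleteSpace K]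
  {E : OrthogonalSpectralMeasure K} {U : K →L[ℂ] K} {A B : Set UnitCircle}

theorem inner_toFun_left (E : OrthogonalSpectralMeasure K) (hA : MeasurableSet A) (x y : K) :
    inner ℂ (E.toFun A x) y = inner ℂ x (E.toFun A y) :=
  (E.isStarProjection A hA).isSelfAdjoint.isSymmetric x y

theorem inner_toFun_self (E : OrthogonalSpectralMeasure K) (hA : MeasurableSet A) (x : K) :
    inner ℂ x (E.toFun A x) = (‖E.toFun A x‖ ^ 2 : ℝ) := by
  have hidem : E.toFun A (E.toFun A x) = E.toFun A x :=
    DFunLike.congr_fun (E.isStarProjection A hA).isIdempotentElem.eq x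
  rw [← hidem, ← E.inner_toFun_left hA, hidem, inner_self_eq_norm_sq_to_K]
  simp

theorem scalarMeasure_real_apply (E : OrthogonalSpectralMeasure K) (hA : MeasurableSet A) (x : K) :
    (E.scalarMeasure x).real A = ‖E.toFun A x‖ ^ 2 := by
  rw [measureReal_def, E.scalarMeasure_apply x hA, E.inner_toFun_self hA, Complex.ofReal_re,
    ENNReal.toReal_ofReal (by positivity)]

theorem inner_toFun_self_eq_scalarMeasure (E : OrthogonalSpectralMeasure K) (hA : MeasurableSet A)
    (x : K) : inner ℂ x (E.toFun A x) = (E.scalarMeasure x).real A := by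
  rw [E.inner_toFun_self hA, E.scalarMeasure_real_apply hA]

instance (x : K) : IsFiniteMeasure (E.scalarMeasure x) :=
  ⟨by rw [E.scalarMeasure_apply x .univ]; exact ENNReal.ofReal_lt_top⟩

theorem toFun_union (E : OrthogonalSpectralMeasure K) (hA : MeasurableSet A) (hB : MeasurableSet B)
    (hAB : Disjoint A B) : E.toFun (A ∪ B) = E.toFun A + E.toFun B :=
  eq_of_inner_apply_self fun x => by
    rw [add_apply, inner_add_right, E.inner_toFun_self_eq_scalarMeasure hA,
      E.inner_toFun_self_eq_scalarMeasure hB, E.inner_toFun_self_eq_scalarMeasure (hA.union hB),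
      measureReal_union hAB hB, Complex.ofReal_add]

theorem toFun_mul_of_disjoint (E : OrthogonalSpectralMeasure K) (hA : MeasurableSet A)
    (hB : MeasurableSet B) (hAB : Disjoint A B) : E.toFun A * E.toFun B = 0 := by
  have hpA := (E.isStarProjection A hA).isIdempotentElem
  have hpB := (E.isStarProjection B hB).isIdempotentElem
  have hadd := (E.isStarProjection (A ∪ B) (hA.union hB)).isIdempotentElem
  rw [E.toFun_union hA hB hAB, hpA.add_iff hpB] at hadd
  have : IsAddTorsionFree (K →L[ℂ] K) := .of_isTorsionFree ℂ _
  exact hpA.mul_eq_zero_of_anticommute hadd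

theorem toFun_mul (E : OrthogonalSpectralMeasure K) (hA : MeasurableSet A) (hB : MeasurableSet B) :
    E.toFun A * E.toFun B = E.toFun (A ∩ B) := by
  have hA_split : E.toFun A = E.toFun (A \ B) + E.toFun (A ∩ B) := by
    rw [← E.toFun_union (hA.diff hB) (hA.inter hB) Set.disjoint_sdiff_inter, Set.sdiff_union_inter]
  have hB_split : E.toFun B = E.toFun (B \ A) + E.toFun (A ∩ B) := by
    rw [Set.inter_comm, ← E.toFun_union (hB.diff hA) (hB.inter hA) Set.disjoint_sdiff_inter,
      Set.sdiff_union_inter]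
  rw [hA_split, add_mul, E.toFun_mul_of_disjoint (hA.diff hB) hB Set.disjoint_sdiff_left, zero_add,
    hB_split, mul_add,
    E.toFun_mul_of_disjoint (hA.inter hB) (hB.diff hA)
      (Set.disjoint_sdiff_right.mono_left Set.inter_subset_left), zero_add,
    (E.isStarProjection _ (hA.inter hB)).isIdempotentElem.eq]

theorem toFun_apply_add_compl (E : OrthogonalSpectralMeasure K) (hA : MeasurableSet A) (x : K) :
    E.toFun A x + E.toFun Aᶜ x = x := by
  rw [← add_apply, ← E.toFun_union hA hA.compl disjoint_compl_right,
    Set.union_compl_self, E.univ, one_apply_eq_self]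

theorem scalarMeasure_toFun (E : OrthogonalSpectralMeasure K) (hA : MeasurableSet A) (x : K) :
    E.scalarMeasure (E.toFun A x) = (E.scalarMeasure x).restrict A := by
  ext B hB
  rw [Measure.restrict_apply hB, ← measureReal_eq_measureReal_iff, E.scalarMeasure_real_apply hB,
    E.scalarMeasure_real_apply (hB.inter hA), ← E.toFun_mul hB hA]
  rfl

namespace IsSpectralMeasureOf

theorem inner_toFun_apply_toFun (hE : E.IsSpectralMeasureOf U) (hA : MeasurableSet A) (x : K) :
    inner ℂ x ((E.toFun A * U * E.toFun A) x) = ∫ ζ in A, (ζ : ℂ) ∂(E.scalarMeasure x) := by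
  rw [← E.scalarMeasure_toFun hA, ← hE, E.inner_toFun_left hA]
  rfl

theorem eq_compress_add_compress_compl (hE : E.IsSpectralMeasureOf U) (hA : MeasurableSet A) :
    U = E.toFun A * U * E.toFun A + E.toFun Aᶜ * U * E.toFun Aᶜ :=
  eq_of_inner_apply_self fun x => by
    rw [add_apply, inner_add_right, hE.inner_toFun_apply_toFun hA,
      hE.inner_toFun_apply_toFun hA.compl, hE x]
    exact (integral_add_compl hA (integrable_of_continuous _ continuous_subtype_val)).symm

theorem commute (hE : E.IsSpectralMeasureOf U) (hA : MeasurableSet A) :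
    Commute U (E.toFun A) := by
  have hidem := (E.isStarProjection A hA).isIdempotentElem.eq
  have hAc : E.toFun A * E.toFun Aᶜ = 0 := E.toFun_mul_of_disjoint hA hA.compl disjoint_compl_right
  have hcA : E.toFun Aᶜ * E.toFun A = 0 := E.toFun_mul_of_disjoint hA.compl hA disjoint_compl_left
  calc U * E.toFun A = E.toFun A * U * E.toFun A := by
        nth_rw 1 [hE.eq_compress_add_compress_compl hA]
        simp only [add_mul, mul_assoc, hidem, hcA, mul_zero, add_zero]
    _ = E.toFun A * U := by
        nth_rw 2 [hE.eq_compress_add_compress_compl hA]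
        simp only [mul_add, ← mul_assoc, hidem, hAc, zero_mul, add_zero]

theorem norm_sq_sub_smul (hE : E.IsSpectralMeasureOf U) (hU : U ∈ unitary (K →L[ℂ] K)) (z : ℂ)
    (x : K) : ‖x - z • U x‖ ^ 2 = ∫ ζ : UnitCircle, ‖1 - z * (ζ : ℂ)‖ ^ 2 ∂(E.scalarMeasure x) := by
  have hexpand (ζ : UnitCircle) :
      ‖1 - z * (ζ : ℂ)‖ ^ 2 = (1 + ‖z‖ ^ 2) - 2 * (z * (ζ : ℂ)).re := by
    rw [@norm_sub_sq ℂ, norm_mul, norm_eq_of_mem_sphere]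
    simp only [norm_one, RCLike.inner_apply, map_one, mul_one, RCLike.re_eq_complex_re]
    ring
  have hre : ∫ ζ : UnitCircle, (z * (ζ : ℂ)).re ∂(E.scalarMeasure x) =
      (z * inner ℂ x (U x)).re := by
    rw [hE x, ← integral_const_mul]
    exact integral_re
      (integrable_of_continuous _ (continuous_const.mul continuous_subtype_val))
  have htotal : (E.scalarMeasure x).real Set.univ = ‖x‖ ^ 2 := by
    rw [E.scalarMeasure_real_apply .univ, E.univ, one_apply_eq_self]
  simp only [hexpand]
  rw [integral_sub (integrable_const _) (integrable_of_continuous _ (by fun_prop)),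
    integral_const_mul, hre, integral_const, htotal, @norm_sub_sq ℂ, norm_smul,
    ContinuousLinearMap.norm_map_of_mem_unitary hU, inner_smul_right, smul_eq_mul,
    RCLike.re_eq_complex_re]
  ring

theorem norm_sq_toFun_sub_smul (hE : E.IsSpectralMeasureOf U) (hU : U ∈ unitary (K →L[ℂ] K))
    (hA : MeasurableSet A) (z : ℂ) (x : K) :
    ‖E.toFun A x - z • U (E.toFun A x)‖ ^ 2 =
      ∫ ζ in A, ‖1 - z * (ζ : ℂ)‖ ^ 2 ∂(E.scalarMeasure x) := by
  rw [hE.norm_sq_sub_smul hU, E.scalarMeasure_toFun hA]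

theorem mul_norm_toFun_le (hE : E.IsSpectralMeasureOf U) (hU : U ∈ unitary (K →L[ℂ] K))
    (hA : MeasurableSet A) {z : ℂ} {c : ℝ} (hc0 : 0 ≤ c) (hc : ∀ ζ ∈ A, c ≤ ‖1 - z * (ζ : ℂ)‖)
    (x : K) : c * ‖E.toFun A x‖ ≤ ‖E.toFun A x - z • U (E.toFun A x)‖ := by
  refine le_of_sq_le_sq ?_ (norm_nonneg _)
  rw [mul_pow, ← E.scalarMeasure_real_apply hA, hE.norm_sq_toFun_sub_smul hU hA]
  exact setIntegral_ge_of_const_le_real hA (measure_ne_top _ _)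
    (fun ζ hζ => pow_le_pow_left₀ hc0 (hc ζ hζ) 2)
    (integrable_of_continuous _ (by fun_prop)).integrableOn

theorem norm_toFun_sub_smul_le (hE : E.IsSpectralMeasureOf U) (hU : U ∈ unitary (K →L[ℂ] K))
    (hA : MeasurableSet A) {z : ℂ} {c : ℝ} (hc0 : 0 ≤ c) (hc : ∀ ζ ∈ A, ‖1 - z * (ζ : ℂ)‖ ≤ c)
    (x : K) : ‖E.toFun A x - z • U (E.toFun A x)‖ ≤ c * ‖E.toFun A x‖ := by
  refine le_of_sq_le_sq ?_ (by positivity)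
  rw [mul_pow, ← E.scalarMeasure_real_apply hA, hE.norm_sq_toFun_sub_smul hU hA]
  refine (Real.le_norm_self _).trans (norm_setIntegral_le_of_norm_le_const (measure_lt_top _ _) ?_)
  intro ζ hζ
  rw [norm_pow, norm_norm]
  exact pow_le_pow_left₀ (norm_nonneg _) (hc ζ hζ) 2

theorem isUnit_one_sub_smul_mul_toFun (hE : E.IsSpectralMeasureOf U)
    (hU : U ∈ unitary (K →L[ℂ] K)) (hA : IsClosed A) {z : ℂ} (hz : ∀ ζ ∈ A, z * (ζ : ℂ) ≠ 1) :
    IsUnit (1 - z • (U * E.toFun A)) := by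
  have hm := hA.measurableSet
  obtain ⟨c, hc, hle⟩ := hA.isCompact.exists_forall_le'
    (f := fun ζ : UnitCircle => ‖1 - z * (ζ : ℂ)‖) (by fun_prop) (a := 0) fun ζ hζ =>
      norm_pos_iff.mpr (sub_ne_zero.mpr (hz ζ hζ).symm)
  exact isUnit_one_sub_smul_mul_of_bounded_below (isStarNormal_of_mem_unitary hU)
    (E.isStarProjection A hm) (hE.commute hm) hc (hE.mul_norm_toFun_le hU hm hc.le hle)

theorem isUnit_one_sub_smul (hE : E.IsSpectralMeasureOf U) (hU : U ∈ unitary (K →L[ℂ] K)) {z : ℂ}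
    (hz : z ∈ offCircle) : IsUnit (1 - z • U) := by
  have h := hE.isUnit_one_sub_smul_mul_toFun hU isClosed_univ
    fun ζ _ => mul_ne_one_of_notMem (Δ := ∅) (Or.inl hz) (Set.notMem_empty ζ)
  rwa [E.univ, mul_one] at h

theorem norm_toFun_le_mul_norm_inverse (hE : E.IsSpectralMeasureOf U)
    (hU : U ∈ unitary (K →L[ℂ] K)) (hA : MeasurableSet A) {z : ℂ} (hz : IsUnit (1 - z • U))
    {c : ℝ} (hc0 : 0 ≤ c) (hc : ∀ ζ ∈ A, ‖1 - z * (ζ : ℂ)‖ ≤ c) (x : K) :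
    ‖E.toFun A x‖ ≤ c * ‖Ring.inverse (1 - z • U) x‖ := by
  set y := Ring.inverse (1 - z • U) x
  have hx : E.toFun A x = E.toFun A y - z • U (E.toFun A y) := by
    have hcomm : Commute (1 - z • U) (E.toFun A) :=
      (Commute.one_left _).sub_left ((hE.commute hA).smul_left z)
    exact DFunLike.congr_fun (show E.toFun A =
      (1 - z • U) * E.toFun A * Ring.inverse (1 - z • U) by
        rw [hcomm.eq, mul_assoc, Ring.mul_inverse_cancel _ hz, mul_one]) x
  calc ‖E.toFun A x‖ ≤ c * ‖E.toFun A y‖ := hx ▸ hE.norm_toFun_sub_smul_le hU hA hc0 hc y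
    _ ≤ c * ‖y‖ := by
      gcongr
      simpa using (E.toFun A).le_of_opNorm_le (E.isStarProjection A hA).norm_le y

end IsSpectralMeasureOf

end OrthogonalSpectralMeasure

section CaratheodoryForm

variable {H : Type*} [NormedAddCommGroup H] [InnerProductSpace ℂ H]
  {K : Type*} [NormedAddCommGroup K] [InnerProductSpace ℂ K] [CompleteSpace K]

/-- The real part of the quadratic form of `2 T - 1`. If `T = (1 - z U)⁻¹`, then
`2 T - 1 = (1 + z U) (1 - z U)⁻¹` is the Carathéodory function of the unitary operator `U`, and the
form at `x` is the Poisson integral of the scalar spectral measure of `x`. -/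
noncomputable def caratheodoryForm (T : H →L[ℂ] H) (x : H) : ℝ :=
  2 * (inner ℂ x (T x)).re - ‖x‖ ^ 2

theorem differentiableAt_caratheodoryForm {G : ℂ → H →L[ℂ] H} {z : ℂ} (hG : DifferentiableAt ℂ G z)
    (x : H) : DifferentiableAt ℝ (fun w => caratheodoryForm (G w) x) z := by
  have hinner : DifferentiableAt ℂ (fun w => inner ℂ x (G w x)) z :=
    (innerSL ℂ x).differentiableAt.comp z (hG.clm_apply (differentiableAt_const x))
  exact ((Complex.reCLM.differentiableAt.comp z (hinner.restrictScalars ℝ)).const_mul 2).sub_const _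

theorem caratheodoryForm_inverse_one_sub_smul {U : K →L[ℂ] K} (hU : U ∈ unitary (K →L[ℂ] K)) {z : ℂ}
    (hz : IsUnit (1 - z • U)) (x : K) :
    caratheodoryForm (Ring.inverse (1 - z • U)) x =
      (1 - ‖z‖ ^ 2) * ‖Ring.inverse (1 - z • U) x‖ ^ 2 := by
  rw [caratheodoryForm]
  set y := Ring.inverse (1 - z • U) x
  have hy : y - x = z • U y := by
    have hx : y - z • U y = x := DFunLike.congr_fun (Ring.mul_inverse_cancel _ hz) x
    rw [← hx, sub_sub_cancel]
  have hnorm : ‖z‖ ^ 2 * ‖y‖ ^ 2 = ‖y‖ ^ 2 - 2 * (inner ℂ x y).re + ‖x‖ ^ 2 := by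
    rw [← RCLike.re_eq_complex_re, inner_re_symm, ← norm_sub_sq, hy, norm_smul,
      ContinuousLinearMap.norm_map_of_mem_unitary hU, mul_pow]
  linear_combination hnorm

theorem scalarMeasure_closedBall_le {E : OrthogonalSpectralMeasure K} {U : K →L[ℂ] K}
    (hE : E.IsSpectralMeasureOf U) (hU : U ∈ unitary (K →L[ℂ] K)) (x : K) (ζ : UnitCircle)
    {ε : ℝ} (hε : ε ∈ Set.Ioo (0 : ℝ) 1) :
    (E.scalarMeasure x).real (closedBall ζ ε) ≤ 4 * ε *
      caratheodoryForm (Ring.inverse (1 - ((1 - ε : ℝ) * starRingEnd ℂ ζ) • U)) x := by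
  have ⟨hε0, hε1⟩ := hε
  set z : ℂ := (1 - ε : ℝ) * starRingEnd ℂ ζ
  have hz : ‖z‖ = 1 - ε := norm_ofReal_mul_conj ζ (by linarith)
  have hunit : IsUnit (1 - z • U) :=
    hE.isUnit_one_sub_smul hU (ofReal_mul_conj_mem_offCircle ζ hε)
  have hbound := hE.norm_toFun_le_mul_norm_inverse hU measurableSet_closedBall hunit (by positivity)
    (fun ξ hξ => norm_one_sub_mul_le_of_mem_closedBall hε0.le hξ) x
  rw [caratheodoryForm_inverse_one_sub_smul hU hunit, hz,
    E.scalarMeasure_real_apply measurableSet_closedBall]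
  set y := Ring.inverse (1 - z • U) x
  calc ‖E.toFun (closedBall ζ ε) x‖ ^ 2 ≤ (2 * ε * ‖y‖) ^ 2 := by gcongr
    _ = 4 * ε * (ε * ‖y‖ ^ 2) := by ring
    _ ≤ 4 * ε * ((1 - (1 - ε) ^ 2) * ‖y‖ ^ 2) := by
      gcongr
      nlinarith

end CaratheodoryForm

namespace UnitaryExtension

variable {H : Type*} [NormedAddCommGroup H] [InnerProductSpace ℂ H] [CompleteSpace H]
  {V : H →ₗ.[ℂ] H}
  {K : Type*} [NormedAddCommGroup K] [InnerProductSpace ℂ K] [CompleteSpace K]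
  {E : OrthogonalSpectralMeasure K} {A Δ : Set UnitCircle}

theorem inner_compression (W : UnitaryExtension V K) (T : K →L[ℂ] K) (x y : H) :
    inner ℂ x (W.compression T y) = inner ℂ (W.incl x) (T (W.incl y)) := by
  simp [compression, ContinuousLinearMap.adjoint_inner_right]

theorem spectralMeasure_eq_zero_iff (W : UnitaryExtension V K) (hA : MeasurableSet A) :
    W.spectralMeasure E A = 0 ↔ ∀ x, E.toFun A (W.incl x) = 0 := by
  refine ⟨fun h x => ?_, fun h => ?_⟩
  · have hinner := W.inner_compression (E.toFun A) x x
    rw [← spectralMeasure, h, E.inner_toFun_self hA] at hinner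
    simpa using hinner.symm
  · ext x
    simp [spectralMeasure, compression, h x]

theorem analyticAt_compression (W : UnitaryExtension V K) {f : ℂ → K →L[ℂ] K} {z : ℂ}
    (hf : AnalyticAt ℂ f z) : AnalyticAt ℂ (fun w => W.compression (f w)) z := by
  let J : H →L[ℂ] K := W.incl.toContinuousLinearMap
  let L : (K →L[ℂ] K) →L[ℂ] (H →L[ℂ] H) :=
    ContinuousLinearMap.compL ℂ H K H J.adjoint ∘L (ContinuousLinearMap.compL ℂ H K K).flip J
  exact (L.analyticAt (f z)).comp hf

theorem caratheodoryForm_generalizedResolvent (W : UnitaryExtension V K) {z : ℂ}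
    (x : H) : caratheodoryForm (W.generalizedResolvent z) x =
      caratheodoryForm (Ring.inverse (1 - z • W.op)) (W.incl x) := by
  rw [caratheodoryForm, caratheodoryForm, generalizedResolvent, W.inner_compression,
    W.incl.norm_map]

theorem hasAnalyticContinuation_of_spectralMeasure_eq_zero (W : UnitaryExtension V K)
    (hE : E.IsSpectralMeasureOf W.op) (hΔ : IsOpen Δ) (h : W.spectralMeasure E Δ = 0) :
    HasAnalyticContinuation W.generalizedResolvent offCircle (offCircle ∪ conjArc Δ) := by
  have hm := hΔ.measurableSet
  have hincl (x : H) : E.toFun Δᶜ (W.incl x) = W.incl x := by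
    simpa only [(W.spectralMeasure_eq_zero_iff hm).mp h x, zero_add] using
      E.toFun_apply_add_compl hm (W.incl x)
  set Q := E.toFun Δᶜ
  have hunit {z : ℂ} (hz : z ∈ offCircle ∪ conjArc Δ) : IsUnit (1 - z • (W.op * Q)) :=
    hE.isUnit_one_sub_smul_mul_toFun W.op_unitary hΔ.isClosed_compl
      fun ζ hζ => mul_ne_one_of_notMem hz hζ
  refine ⟨fun z => W.compression (Ring.inverse (1 - z • (W.op * Q))), fun z hz => ?_,
    fun z hz => ?_⟩
  · obtain ⟨u, hu⟩ := hunit hz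
    have hlin : AnalyticAt ℂ (fun w : ℂ => 1 - w • (W.op * Q)) z := by fun_prop
    exact W.analyticAt_compression (AnalyticAt.fun_comp (hu ▸ analyticAt_inverse u) hlin)
  · have hinv : Ring.inverse (1 - z • (W.op * Q)) * Q = Ring.inverse (1 - z • W.op) * Q := by
      rw [← smul_mul_assoc]
      exact inverse_one_sub_mul_mul (E.isStarProjection _ hm.compl).isIdempotentElem
        ((hE.commute hm.compl).smul_left z) (hE.isUnit_one_sub_smul W.op_unitary hz)
        (smul_mul_assoc z W.op Q ▸ hunit (Or.inl hz))
    ext x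
    have happly := DFunLike.congr_fun hinv (W.incl x)
    rw [mul_apply_eq_comp, mul_apply_eq_comp, hincl] at happly
    exact congrArg W.incl.toContinuousLinearMap.adjoint happly

theorem caratheodoryForm_eq_zero_of_continuousAt (W : UnitaryExtension V K)
    (hE : E.IsSpectralMeasureOf W.op) {G : ℂ → H →L[ℂ] H}
    (hGR : Set.EqOn G W.generalizedResolvent offCircle) {z : ℂ} (hz : ‖z‖ = 1) {x : H}
    (hG : ContinuousAt (fun w => caratheodoryForm (G w) x) z) : caratheodoryForm (G z) x = 0 := by
  have hform {w : ℂ} (hw : w ∈ offCircle) : caratheodoryForm (G w) x =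
      (1 - ‖w‖ ^ 2) * ‖Ring.inverse (1 - w • W.op) (W.incl x)‖ ^ 2 := by
    rw [hGR hw, W.caratheodoryForm_generalizedResolvent, caratheodoryForm_inverse_one_sub_smul
      W.op_unitary (hE.isUnit_one_sub_smul W.op_unitary hw)]
  refine le_antisymm ?_ ?_
  · have : (𝓝[(closedBall (0 : ℂ) 1)ᶜ] z).NeBot := by
      rw [← mem_closure_iff_nhdsWithin_neBot, closure_compl, interior_closedBall _ one_ne_zero]
      simp [hz]
    refine le_of_tendsto (x := 𝓝[(closedBall (0 : ℂ) 1)ᶜ] z) (hG.mono_left nhdsWithin_le_nhds)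
      (eventually_nhdsWithin_of_forall fun w hw => ?_)
    have hw1 : 1 < ‖w‖ := by simpa using hw
    rw [hform (Or.inr hw1)]
    exact mul_nonpos_of_nonpos_of_nonneg (by nlinarith) (sq_nonneg _)
  · have : (𝓝[ball (0 : ℂ) 1] z).NeBot := by
      rw [← mem_closure_iff_nhdsWithin_neBot, closure_ball _ one_ne_zero]
      simp [hz]
    refine ge_of_tendsto (x := 𝓝[ball (0 : ℂ) 1] z) (hG.mono_left nhdsWithin_le_nhds)
      (eventually_nhdsWithin_of_forall fun w hw => ?_)
    have hw1 : ‖w‖ < 1 := by simpa using hw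
    rw [hform (Or.inl hw1)]
    exact mul_nonneg (by nlinarith [norm_nonneg w]) (sq_nonneg _)

theorem isBigO_scalarMeasure_closedBall (W : UnitaryExtension V K)
    (hE : E.IsSpectralMeasureOf W.op) {G : ℂ → H →L[ℂ] H}
    (hGR : Set.EqOn G W.generalizedResolvent offCircle) (ζ : UnitCircle)
    (hG : DifferentiableAt ℂ G (starRingEnd ℂ ζ)) (x : H) :
    (fun ε => (E.scalarMeasure (W.incl x)).real (closedBall ζ ε)) =O[𝓝[>] 0] fun ε => ε ^ 2 := by
  let q (w : ℂ) : ℝ := caratheodoryForm (G w) x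
  let z (ε : ℝ) : ℂ := (1 - ε : ℝ) * starRingEnd ℂ ζ
  have hq : DifferentiableAt ℝ q (starRingEnd ℂ ζ) := differentiableAt_caratheodoryForm hG x
  have hq0 : q (starRingEnd ℂ ζ) = 0 :=
    W.caratheodoryForm_eq_zero_of_continuousAt hE hGR (by simp) hq.continuousAt
  have hz : Tendsto z (𝓝[>] 0) (𝓝 (starRingEnd ℂ ζ)) := by
    have hcont : Continuous z := by fun_prop
    simpa [z] using (hcont.tendsto 0).mono_left nhdsWithin_le_nhds
  have hqz : (fun ε => q (z ε)) =O[𝓝[>] 0] fun ε => ε := by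
    have hstep (ε : ℝ) : z ε - starRingEnd ℂ ζ = -ε * starRingEnd ℂ ζ := by
      simp only [z]
      push_cast
      ring
    have hsub := hq.isBigO_sub.comp_tendsto hz
    simp only [Function.comp_def, hq0, sub_zero, hstep] at hsub
    exact hsub.trans (.of_bound 1 (.of_forall fun ε => by simp))
  have hle : ∀ᶠ ε in 𝓝[>] (0 : ℝ),
      ‖(E.scalarMeasure (W.incl x)).real (closedBall ζ ε)‖ ≤ 4 * ‖ε * q (z ε)‖ := by
    filter_upwards [Ioo_mem_nhdsGT one_pos] with ε hε
    have hball := scalarMeasure_closedBall_le hE W.op_unitary (W.incl x) ζ hε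
    rw [← W.caratheodoryForm_generalizedResolvent, ← hGR (ofReal_mul_conj_mem_offCircle ζ hε)]
      at hball
    calc ‖(E.scalarMeasure (W.incl x)).real (closedBall ζ ε)‖ ≤ 4 * ε * q (z ε) :=
          (Real.norm_of_nonneg measureReal_nonneg).trans_le hball
      _ = 4 * (ε * q (z ε)) := mul_assoc _ _ _
      _ ≤ 4 * ‖ε * q (z ε)‖ := by
        gcongr
        exact Real.le_norm_self _
  simpa only [sq] using (IsBigO.of_bound 4 hle).trans ((isBigO_refl _ _).mul hqz)

theorem spectralMeasure_eq_zero_of_hasAnalyticContinuation (W : UnitaryExtension V K)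
    (hE : E.IsSpectralMeasureOf W.op) (hΔ : MeasurableSet Δ)
    (h : HasAnalyticContinuation W.generalizedResolvent offCircle (offCircle ∪ conjArc Δ)) :
    W.spectralMeasure E Δ = 0 := by
  obtain ⟨G, hG, hGR⟩ := h
  refine (W.spectralMeasure_eq_zero_iff hΔ).mpr fun x => ?_
  have hnull : E.scalarMeasure (W.incl x) Δ = 0 :=
    measure_eq_zero_of_isBigO_closedBall_sq _ fun ζ hζ =>
      W.isBigO_scalarMeasure_closedBall hE hGR ζ
        (hG _ (Or.inr ⟨ζ, hζ, Complex.conj_conj _⟩)).differentiableAt x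
  simpa [measureReal_def, hnull] using (E.scalarMeasure_real_apply hΔ (W.incl x)).symm

end UnitaryExtension

end

theorem proposition3p1_general
    {H : Type*} [NormedAddCommGroup H] [InnerProductSpace ℂ H] [CompleteSpace H]
    {V : H →ₗ.[ℂ] H}
    {K : Type*} [NormedAddCommGroup K] [InnerProductSpace ℂ K] [CompleteSpace K]
    (W : UnitaryExtension V K)
    (E : OrthogonalSpectralMeasure K) (hE : E.IsSpectralMeasureOf W.op)
    (Δ : Set UnitCircle) (hΔ : IsOpen Δ) :
    W.spectralMeasure E Δ = 0 ↔
      HasAnalyticContinuation W.generalizedResolvent offCircle (offCircle ∪ conjArc Δ) :=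
  ⟨W.hasAnalyticContinuation_of_spectralMeasure_eq_zero hE hΔ,
    W.spectralMeasure_eq_zero_of_hasAnalyticContinuation hE hΔ.measurableSet⟩

theorem proposition3p1
    {H : Type*} [NormedAddCommGroup H] [InnerProductSpace ℂ H] [CompleteSpace H]
    (V : H →ₗ.[ℂ] H) (hV : IsClosedIsometric V)
    {K : Type*} [NormedAddCommGroup K] [InnerProductSpace ℂ K] [CompleteSpace K]
    (W : UnitaryExtension V K)
    (E : OrthogonalSpectralMeasure K) (hE : E.IsSpectralMeasureOf W.op)
    (Δ : Set UnitCircle) (hΔ : IsOpenArc Δ) :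
    W.spectralMeasure E Δ = 0 ↔
      HasAnalyticContinuation W.generalizedResolvent offCircle (offCircle ∪ conjArc Δ) :=
  proposition3p1_general W E hE Δ hΔ.isOpen
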